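/- Let $R$ be a noetherian local (commutative) ring with residue field $k$, and let $E$ be an injective hull of the $R$-module $k$. For an $R$-module $M$ write $M^\circ=\operatorname{Hom}_R(M,E)$ for its Matlis dual and let $\varphi: M\to M^{\circ\circ}$, $\varphi(x)(f)=f(x)$, be the canonical embedding. For a prime ideal $\mathfrak p$ of $R$ let $\kappa(\mathfrak p)=R_{\mathfrak p}/\mathfrak pR_{\mathfrak p}$ and let $$\mu(\mathfrak p,M)=\dim_{\kappa(\mathfrak p)}\bigl(\operatorname{Hom}_R(R/\mathfrak p,M)_{\mathfrak p}\bigr)$$ be the (zeroth) Bass number of $M$ at $\mathfrak p$, a possibly infinite cardinal number. Then for every $R$-module $M$ and every prime ideal $\mathfrak p$ of $R$, $$\mu(\mathfrak p,M)=\mu(\mathfrak p,M^{\circ\circ})\iff \mathfrak p\notin\operatorname{Ass}_R(\operatorname{Coker}\varphi).$$ -/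

import Mathlib

universe u v w

/-- `ι : N →ₗ[R] E` exhibits `E` as an injective hull of the `R`-module `N`: the module `E` is
injective, `ι` is a monomorphism, and its image is a large (essential) submodule of `E`. -/
structure IsInjectiveHull {R : Type u} [CommRing R] {N : Type v} [AddCommGroup N] [Module R N]
    {E : Type w} [AddCommGroup E] [Module R E] (ι : N →ₗ[R] E) : Prop where
  injective_module : Module.Injective R E
  injective_map : Function.Injective ι
  essential : ∀ U : Submodule R E, U ⊓ LinearMap.range ι = ⊥ → U = ⊥

/-- The dual `M° = Hom_R(M, E)`; it is the Matlis dual when `R` is noetherian local and `E` is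
the injective hull of the residue field. -/
abbrev MatlisDual (R : Type u) [CommRing R] (E : Type w) [AddCommGroup E] [Module R E]
    (M : Type v) [AddCommGroup M] [Module R M] : Type (max v w) :=
  M →ₗ[R] E

/-- The canonical map `φ : M → M°°`, `φ x = (f ↦ f x)`. -/
def matlisEval (R : Type u) [CommRing R] (E : Type w) [AddCommGroup E] [Module R E]
    (M : Type v) [AddCommGroup M] [Module R M] :
    M →ₗ[R] MatlisDual R E (MatlisDual R E M) :=
  LinearMap.applyₗ

/-- The localization `Hom_R(R/p, M)_p`, a module over `R_p`. -/
abbrev HomLocalization {R : Type u} [CommRing R] (p : Ideal R) [p.IsPrime]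
    (M : Type v) [AddCommGroup M] [Module R M] : Type (max u v) :=
  LocalizedModule p.primeCompl ((R ⧸ p) →ₗ[R] M)

/-- `Hom_R(R/p, M)_p` is annihilated by the maximal ideal of `R_p`. -/
theorem homLocalization_isTorsionBySet {R : Type u} [CommRing R] (p : Ideal R) [p.IsPrime]
    (M : Type v) [AddCommGroup M] [Module R M] :
    Module.IsTorsionBySet (Localization.AtPrime p) (HomLocalization p M)
      (IsLocalRing.maximalIdeal (Localization.AtPrime p) : Set (Localization.AtPrime p)) := by
  rw [← Localization.AtPrime.map_eq_maximalIdeal, Ideal.map]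
  rw [← Module.isTorsionBySet_iff_is_torsion_by_span]
  rintro x ⟨_, r, hr, rfl⟩
  induction x using LocalizedModule.induction_on with
  | h f s =>
    have hf : r • f = 0 := by
      ext
      have h1 : (r • (1 : R ⧸ p)) = 0 := by
        rw [Algebra.smul_def, mul_one]
        exact Ideal.Quotient.eq_zero_iff_mem.mpr hr
      simp only [LinearMap.coe_comp, Function.comp_apply, LinearMap.smul_apply]
      simpa using congrArg f h1
    change algebraMap R (Localization.AtPrime p) r • LocalizedModule.mk f s = 0
    rw [algebraMap_smul, LocalizedModule.smul'_mk, hf, LocalizedModule.zero_mk]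

/-- The resulting vector space structure of `Hom_R(R/p, M)_p` over
`κ(p) = R_p / pR_p`: the class of `a ∈ R_p` acts as `a`. -/
noncomputable instance homLocalizationModule {R : Type u} [CommRing R] (p : Ideal R) [p.IsPrime]
    (M : Type v) [AddCommGroup M] [Module R M] :
    Module p.ResidueField (HomLocalization p M) :=
  Module.IsTorsionBySet.module (homLocalization_isTorsionBySet p M)

/-- The (zeroth) Bass number `μ(p, M) = dim_{κ(p)} (Hom_R(R/p, M)_p)`, a cardinal. -/
noncomputable def bassNumber {R : Type u} [CommRing R] (p : Ideal R) [p.IsPrime]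
    (M : Type v) [AddCommGroup M] [Module R M] : Cardinal.{max u v} :=
  Module.rank p.ResidueField (HomLocalization p M)

/-!
Write `M[p]` for the submodule of elements of `M` killed by `p`; it is `Hom(R/p, M)`. The embedding
`φ : M → M°°` is pure: since `E` is an injective cogenerator, a finite system of linear equations
over `M` that is solvable in `M°°` is solvable in `M`
(`IsInjectiveHull.exists_smul_sub_matlisEval_eq_zero` is the instance needed). As `p` is finitely
generated, every element of `Coker φ` killed by `p` therefore lifts to an element of `M°°[p]`, so
that `p ∉ Ass (Coker φ)` means exactly that the injection `Hom(R/p, M)_p → Hom(R/p, M°°)_p` of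
vector spaces over `κ(p)` is onto (`IsInjectiveHull.not_isAssociatedPrime_coker_iff`). In that case
the two dimensions agree. If they agree and are finite, then the injection is onto.

It remains to see that an infinite Bass number strictly increases
(`IsInjectiveHull.bassNumber_lt_of_aleph0_le`), so that equality forces finiteness. Let `(m i)`,
`i ∈ I`, be elements of `M[p]` representing a basis of `Hom(R/p, M)_p`. For each `s ⊆ I` there is an
element of `M°°[p]` that sends `f` to `∑ i ∈ s, f (m i)` whenever only finitely many `f (m i)` are
nonzero. Because the `R/p`-module `E[p]` is faithful, such elements are linearly independent as soon
as the indicator functions of the sets `s` are linearly independent in `I → κ(p)`, and there are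
more than `#I` independent indicator functions (`exists_linearIndepOn_indicator`): the span of
finitely many of them contains only finitely many indicator functions, while there are `2 ^ #I` in
all.
-/

/-! ### Linearly independent indicator functions -/

/-- A function in the span of finitely many indicator functions is constant on the atoms of the
finite Boolean algebra generated by the corresponding sets. -/
theorem finite_setOf_indicator_mem_span (K : Type*) [Ring K] [Nontrivial K] {I : Type*}
    {t : Set (Set I)} (ht : t.Finite) :
    {s : Set I | s.indicator (1 : I → K) ∈
      Submodule.span K ((fun u : Set I => u.indicator (1 : I → K)) '' t)}.Finite := by
  have := ht.to_subtype
  let σ : I → Set t := fun i => {u | i ∈ u.1}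
  refine (Set.finite_range fun A : Set (Set t) => σ ⁻¹' A).subset fun s hs => ⟨σ '' s, ?_⟩
  have hconst : ∀ i j, σ i = σ j → s.indicator (1 : I → K) i = s.indicator (1 : I → K) j := by
    intro i j hij
    have hle : Submodule.span K ((fun u : Set I => u.indicator (1 : I → K)) '' t) ≤
        LinearMap.eqLocus (LinearMap.proj (R := K) (φ := fun _ : I => K) i) (LinearMap.proj j) := by
      rw [Submodule.span_le]
      rintro _ ⟨u, hu, rfl⟩
      have hiu : i ∈ u ↔ j ∈ u := Set.ext_iff.mp hij ⟨u, hu⟩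
      by_cases hj : j ∈ u
      · simp [hj, hiu.mpr hj]
      · simp [hj, mt hiu.mp hj]
    exact hle hs
  refine Set.Subset.antisymm ?_ (Set.subset_preimage_image σ s)
  rintro j ⟨i, hi, hij⟩
  have h := hconst i j hij
  by_contra hj
  rw [Set.indicator_of_mem hi, Set.indicator_of_notMem hj] at h
  exact one_ne_zero h

open scoped Classical in
open Cardinal in
/-- Over any field, an infinite set `I` admits more than `#I` linearly independent `{0, 1}`-valued
functions: a maximal independent family `S` of such functions spans all `2 ^ #I` of them, while
each of the finite subsets of `S` accounts for finitely many only. -/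
theorem exists_linearIndepOn_indicator (K : Type*) [Field K] (I : Type*) [Infinite I] :
    ∃ S : Set (Set I), #I < #S ∧
      LinearIndepOn K (fun s : Set I => s.indicator (1 : I → K)) S := by
  obtain ⟨S, -, -, hspan, hS⟩ := exists_linearIndepOn_extension
    (linearIndepOn_empty K (fun s : Set I => s.indicator (1 : I → K))) (Set.empty_subset Set.univ)
  refine ⟨S, ?_, hS⟩
  by_contra! hle
  have hfin : ∀ s : Set I, ∃ T : Finset S, s.indicator (1 : I → K) ∈
      Submodule.span K ((fun u : Set I => u.indicator (1 : I → K)) ''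
        ((fun x : S => x.1) '' (T : Set S))) := by
    intro s
    obtain ⟨T, hT, hsT⟩ := Submodule.mem_span_finite_of_mem_span
      (hspan (Set.mem_image_of_mem _ (Set.mem_univ s)))
    obtain ⟨T', hT', rfl⟩ := Finset.subset_set_image_iff.mp hT
    refine ⟨T'.preimage Subtype.val Subtype.val_injective.injOn, ?_⟩
    rwa [Finset.coe_preimage, Subtype.image_preimage_coe, Set.inter_eq_right.mpr hT',
      ← Finset.coe_image]
  choose F hF using hfin
  have h1 : #(Set I) ≤ #(Finset S) * ℵ₀ :=
    mk_le_mk_mul_of_mk_preimage_le F fun T => by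
      refine (((finite_setOf_indicator_mem_span K
        (T.finite_toSet.image fun x : S => x.1)).subset ?_).lt_aleph0).le
      rintro s rfl
      exact hF s
  obtain ⟨g⟩ := hle
  have h2 : #(Finset S) ≤ #I :=
    (mk_le_of_injective (Finset.map_injective g)).trans (mk_finset_of_infinite I).le
  have h3 : #(Set I) ≤ #I := h1.trans <| (mul_le_mul_left h2 _).trans
    (mul_eq_left (aleph0_le_mk I) (aleph0_le_mk I) aleph0_ne_zero).le
  rw [mk_set] at h3
  exact (cantor _).not_ge h3

/-! ### The vector space `Hom(R/p, M)_p` -/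

section HomLocalization

variable {R : Type*} [CommRing R] (p : Ideal R)

theorem exists_quotient_hom_apply_one {M : Type*} [AddCommGroup M] [Module R M] {m : M}
    (hm : ∀ r ∈ p, r • m = 0) : ∃ w : (R ⧸ p) →ₗ[R] M, w 1 = m :=
  ⟨Submodule.liftQ p (LinearMap.toSpanSingleton R M m) fun r hr => by simpa using hm r hr,
    one_smul R m⟩

theorem quotient_hom_apply_mk {M : Type*} [AddCommGroup M] [Module R M]
    (w : (R ⧸ p) →ₗ[R] M) (r : R) : w (Ideal.Quotient.mk p r) = r • w 1 := by
  rw [← map_smul, Algebra.smul_def, mul_one]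
  rfl

theorem smul_quotient_hom_apply_one {M : Type*} [AddCommGroup M] [Module R M]
    (w : (R ⧸ p) →ₗ[R] M) {r : R} (hr : r ∈ p) : r • w 1 = 0 := by
  rw [← quotient_hom_apply_mk, Ideal.Quotient.eq_zero_iff_mem.mpr hr, map_zero]

theorem quotient_hom_ext {M : Type*} [AddCommGroup M] [Module R M]
    {w w' : (R ⧸ p) →ₗ[R] M} (h : w 1 = w' 1) : w = w' := by
  ext
  exact h

variable [p.IsPrime]

instance homLocalization_isScalarTower (M : Type*) [AddCommGroup M] [Module R M] :
    IsScalarTower (Localization.AtPrime p) p.ResidueField (HomLocalization p M) :=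
  Module.IsTorsionBySet.isScalarTower _

instance homLocalization_isScalarTower_base (M : Type*) [AddCommGroup M] [Module R M] :
    IsScalarTower R p.ResidueField (HomLocalization p M) :=
  Module.IsTorsionBySet.isScalarTower _

/-- Linear independence over `κ(p)` of a family of vectors of any module over `κ(p)` can be tested
with coefficients in `R`, by clearing denominators. -/
theorem linearIndependent_residueField_iff {W : Type*} [AddCommGroup W] [Module R W]
    [Module p.ResidueField W] [IsScalarTower R p.ResidueField W] {ι : Type*} {v : ι → W} :
    LinearIndependent p.ResidueField v ↔
      ∀ (s : Finset ι) (g : ι → R), ∑ i ∈ s, g i • v i = 0 → ∀ i ∈ s, g i ∈ p := by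
  let _ : Module (R ⧸ p) W := Module.compHom W (algebraMap (R ⧸ p) p.ResidueField)
  have : IsScalarTower (R ⧸ p) p.ResidueField W := ⟨fun a b x => by
    rw [Algebra.smul_def, mul_smul]; rfl⟩
  have hmk : ∀ (r : R) (x : W), Ideal.Quotient.mk p r • x = r • x := by
    intro r x
    rw [← IsScalarTower.algebraMap_smul p.ResidueField r x]
    change algebraMap (R ⧸ p) p.ResidueField (Ideal.Quotient.mk p r) • x = _
    rw [Ideal.algebraMap_quotient_residueField_mk]
  rw [← LinearIndependent.iff_fractionRing (R ⧸ p) p.ResidueField, linearIndependent_iff']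
  constructor
  · intro h s g hg i hi
    refine Ideal.Quotient.eq_zero_iff_mem.mp
      (h s (fun i => Ideal.Quotient.mk p (g i)) ?_ i hi)
    simpa only [hmk] using hg
  · intro h s g hg i hi
    obtain ⟨g', rfl⟩ : ∃ g' : ι → R, (fun i => Ideal.Quotient.mk p (g' i)) = g := by
      choose g' hg' using fun i => Ideal.Quotient.mk_surjective (g i)
      exact ⟨g', funext hg'⟩
    refine Ideal.Quotient.eq_zero_iff_mem.mpr (h s g' ?_ i hi)
    simpa only [hmk] using hg

/-- The classes in `Hom(R/p, M)_p` of homomorphisms `w i` are linearly independent over `κ(p)` if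
and only if the elements `w i 1` of `M` are linearly independent over `R/p`. -/
theorem linearIndependent_homLocalization_iff {M : Type*} [AddCommGroup M] [Module R M]
    {ι : Type*} {w : ι → (R ⧸ p) →ₗ[R] M} :
    LinearIndependent p.ResidueField
        (fun i => LocalizedModule.mkLinearMap p.primeCompl ((R ⧸ p) →ₗ[R] M) (w i)) ↔
      ∀ (s : Finset ι) (g : ι → R), ∑ i ∈ s, g i • w i 1 = 0 → ∀ i ∈ s, g i ∈ p := by
  rw [linearIndependent_residueField_iff]
  have happ : ∀ (s : Finset ι) (g : ι → R),
      (∑ i ∈ s, g i • w i) 1 = ∑ i ∈ s, g i • w i 1 := by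
    intro s g
    simp [LinearMap.sum_apply]
  constructor
  · intro h s g hg
    refine h s g ?_
    simp only [← map_smul, ← map_sum]
    rw [quotient_hom_ext p (w := ∑ i ∈ s, g i • w i) (w' := 0) (by rw [happ, hg]; rfl), map_zero]
  · intro h s g hg i hi
    simp only [← map_smul, ← map_sum] at hg
    obtain ⟨u, hu⟩ := (IsLocalizedModule.eq_zero_iff p.primeCompl _).mp hg
    have hug : ∑ i ∈ s, (u.1 * g i) • w i 1 = 0 := by
      have := congrArg (fun f : (R ⧸ p) →ₗ[R] M => f 1) hu
      simpa [Submonoid.smul_def, happ, Finset.smul_sum, mul_smul] using this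
    exact (Ideal.IsPrime.mem_or_mem ‹_› (h s (fun i => u.1 * g i) hug i hi)).resolve_left u.2

/-- The `κ(p)`-linear map `Hom(R/p, M)_p → Hom(R/p, N)_p` induced by `M → N`. -/
noncomputable def homLocalizationMap {M N : Type*} [AddCommGroup M] [Module R M] [AddCommGroup N]
    [Module R N] (f : M →ₗ[R] N) :
    HomLocalization p M →ₗ[p.ResidueField] HomLocalization p N :=
  LinearMap.extendScalarsOfSurjective (R := Localization.AtPrime p) IsLocalRing.residue_surjective
    (LocalizedModule.map p.primeCompl (LinearMap.compRight R (M := R ⧸ p) f))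

theorem homLocalizationMap_mk {M N : Type*} [AddCommGroup M] [Module R M] [AddCommGroup N]
    [Module R N] (f : M →ₗ[R] N) (w : (R ⧸ p) →ₗ[R] M) (s : p.primeCompl) :
    homLocalizationMap p f (LocalizedModule.mk w s) = LocalizedModule.mk (f ∘ₗ w) s := by
  exact LocalizedModule.map_mk p.primeCompl (LinearMap.compRight R (M := R ⧸ p) f) w s

theorem homLocalizationMap_injective {M N : Type*} [AddCommGroup M] [Module R M] [AddCommGroup N]
    [Module R N] {f : M →ₗ[R] N} (hf : Function.Injective f) :
    Function.Injective (homLocalizationMap p f) := by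
  refine LocalizedModule.map_injective p.primeCompl (LinearMap.compRight R (M := R ⧸ p) f) ?_
  intro w w' h
  exact LinearMap.ext fun x => hf (LinearMap.congr_fun h x)

/-- `Hom(R/p, M)_p → Hom(R/p, N)_p` is onto if and only if every element of `N` killed by `p` has
a multiple by a scalar outside `p` that lies in the image of `M`. -/
theorem homLocalizationMap_surjective_iff {M N : Type*} [AddCommGroup M] [Module R M]
    [AddCommGroup N] [Module R N] {f : M →ₗ[R] N} (hf : Function.Injective f) :
    Function.Surjective (homLocalizationMap p f) ↔
      ∀ y : N, (∀ r ∈ p, r • y = 0) → ∃ r ∉ p, r • y ∈ LinearMap.range f := by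
  constructor
  · intro h y hy
    obtain ⟨w, rfl⟩ := exists_quotient_hom_apply_one p hy
    obtain ⟨x, hx⟩ := h (LocalizedModule.mk w 1)
    induction x using LocalizedModule.induction_on with
    | h v s =>
      rw [homLocalizationMap_mk, LocalizedModule.mk_eq] at hx
      obtain ⟨u, hu⟩ := hx
      refine ⟨(u * s : p.primeCompl), (u * s).2, ?_⟩
      have h1 := congrArg (fun g : (R ⧸ p) →ₗ[R] N => g 1) hu
      refine ⟨u.1 • v 1, ?_⟩
      simpa [Submonoid.smul_def, mul_smul] using h1
  · intro h z
    induction z using LocalizedModule.induction_on with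
    | h w s =>
      obtain ⟨r, hr, m, hm⟩ := h (w 1) fun r hr => smul_quotient_hom_apply_one p w hr
      have hm0 : ∀ a ∈ p, a • m = 0 := by
        intro a ha
        apply hf
        rw [map_smul, hm, smul_comm, smul_quotient_hom_apply_one p w ha, smul_zero, map_zero]
      obtain ⟨v, rfl⟩ := exists_quotient_hom_apply_one p hm0
      refine ⟨LocalizedModule.mk v (⟨r, hr⟩ * s), ?_⟩
      rw [homLocalizationMap_mk, LocalizedModule.mk_eq]
      refine ⟨1, quotient_hom_ext p ?_⟩
      simp [Submonoid.smul_def, hm, mul_smul, smul_comm r s.1]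

end HomLocalization

theorem LinearMap.surjective_of_injective_of_rank_eq {K : Type*} [Field K] {V W : Type v}
    [AddCommGroup V] [Module K V] [AddCommGroup W] [Module K W] {f : V →ₗ[K] W}
    (hf : Function.Injective f) (h : Module.rank K V = Module.rank K W)
    (hV : Module.rank K V < Cardinal.aleph0) : Function.Surjective f := by
  have := Module.rank_lt_aleph0_iff.mp hV
  have := Module.rank_lt_aleph0_iff.mp (h ▸ hV)
  exact (LinearMap.injective_iff_surjective_of_finrank_eq_finrank (congrArg Cardinal.toNat h)).mp hf

/-! ### The injective hull of the residue field and the bidual -/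

section Cogenerator

variable {R : Type u} [CommRing R] [IsLocalRing R] {E : Type u} [AddCommGroup E] [Module R E]
  (ι : IsLocalRing.ResidueField R →ₗ[R] E) (hE : IsInjectiveHull ι)

include hE

/-- The injective hull of the residue field is a cogenerator: the nonzero cyclic module generated
by `x` maps onto the residue field. -/
theorem IsInjectiveHull.exists_hom_apply_ne_zero {X : Type*} [AddCommGroup X] [Module R X] {x : X}
    (hx : x ≠ 0) : ∃ g : X →ₗ[R] E, g x ≠ 0 := by
  have := hE.injective_module
  have hle : Ideal.torsionOf R X x ≤ IsLocalRing.maximalIdeal R := by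
    refine IsLocalRing.le_maximalIdeal fun h => hx ?_
    simpa using (Ideal.eq_top_iff_one _).mp h
  let j : (R ⧸ Ideal.torsionOf R X x) →ₗ[R] X :=
    Submodule.liftQ _ (LinearMap.toSpanSingleton R X x) le_rfl
  have hj : Function.Injective j :=
    LinearMap.ker_eq_bot.mp (Submodule.ker_liftQ_eq_bot _ _ _ le_rfl)
  let q : (R ⧸ Ideal.torsionOf R X x) →ₗ[R] E :=
    Submodule.liftQ _ (ι ∘ₗ Algebra.linearMap R (IsLocalRing.ResidueField R)) fun r hr => by
      have h0 : algebraMap R (IsLocalRing.ResidueField R) r = 0 :=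
        (IsLocalRing.residue_eq_zero_iff r).mpr (hle hr)
      change ι (algebraMap R (IsLocalRing.ResidueField R) r) = 0
      rw [h0, map_zero]
  obtain ⟨g, hg⟩ := Module.Injective.extension_property R E _ _ j hj q
  refine ⟨g, ?_⟩
  have h1 : g (j (Submodule.Quotient.mk 1)) = ι 1 := by
    refine (LinearMap.congr_fun hg (Submodule.Quotient.mk 1)).trans ?_
    change ι (algebraMap R (IsLocalRing.ResidueField R) 1) = ι 1
    rw [map_one]
  have h2 : j (Submodule.Quotient.mk 1) = x := one_smul R x
  rw [← h2, h1]
  exact fun h => one_ne_zero (hE.injective_map (h.trans (map_zero ι).symm))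

theorem IsInjectiveHull.matlisEval_injective (M : Type v) [AddCommGroup M] [Module R M] :
    Function.Injective (matlisEval R E M) := by
  rw [injective_iff_map_eq_zero]
  intro x hx
  by_contra h
  obtain ⟨g, hg⟩ := hE.exists_hom_apply_ne_zero ι h
  exact hg (LinearMap.congr_fun hx g)

/-- The submodule `E[p]` of elements killed by `p` is a faithful `R/p`-module. -/
theorem IsInjectiveHull.exists_torsion_smul_ne_zero {p : Ideal R} {a : R} (ha : a ∉ p) :
    ∃ e : E, (∀ r ∈ p, r • e = 0) ∧ a • e ≠ 0 := by
  obtain ⟨g, hg⟩ := hE.exists_hom_apply_ne_zero ι (X := R ⧸ p) (x := Ideal.Quotient.mk p a)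
    (mt Ideal.Quotient.eq_zero_iff_mem.mp ha)
  refine ⟨g 1, fun r hr => smul_quotient_hom_apply_one p g hr, ?_⟩
  rwa [← quotient_hom_apply_mk]

/-- Purity of `φ : M → M°°`, for the finitely many equations `r • m = φ⁻¹ (r • y)` with `r` running
over generators of `p`. If these had no solution in `M`, a functional on a finite power of `M`
would vanish on all `(r • m)_r` but not on the right-hand sides; evaluating `y` at its components
gives a contradiction. -/
theorem IsInjectiveHull.exists_smul_sub_matlisEval_eq_zero {M : Type v} [AddCommGroup M]
    [Module R M] {p : Ideal R} (hp : p.FG) {y : MatlisDual R E (MatlisDual R E M)}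
    (hy : ∀ r ∈ p, r • y ∈ LinearMap.range (matlisEval R E M)) :
    ∃ m : M, ∀ r ∈ p, r • (y - matlisEval R E M m) = 0 := by
  classical
  obtain ⟨t, rfl⟩ := hp
  choose n hn using fun r : t => hy r.1 (Ideal.subset_span r.2)
  let L : M →ₗ[R] (t → M) := LinearMap.pi fun r => r.1 • LinearMap.id
  have hmem : n ∈ LinearMap.range L := by
    by_contra hnot
    obtain ⟨g, hg⟩ := hE.exists_hom_apply_ne_zero ι (x := (LinearMap.range L).mkQ n)
      (mt (Submodule.Quotient.mk_eq_zero _).mp hnot)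
    let G : (t → M) →ₗ[R] E := g ∘ₗ (LinearMap.range L).mkQ
    have hG : ∀ z : t → M, G z = ∑ r, (G ∘ₗ LinearMap.single R (fun _ : t => M) r) (z r) := by
      intro z
      simp only [LinearMap.comp_apply, LinearMap.coe_single]
      rw [← map_sum, Finset.univ_sum_single]
    have hsum : ∑ r : t, r.1 • (G ∘ₗ LinearMap.single R (fun _ : t => M) r) = 0 := by
      ext m
      have h0 : G (L m) = 0 := by
        have : (LinearMap.range L).mkQ (L m) = 0 :=
          (Submodule.Quotient.mk_eq_zero _).mpr ⟨m, rfl⟩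
        simp [G, this]
      rw [hG] at h0
      rw [LinearMap.sum_apply, LinearMap.zero_apply, ← h0]
      refine Finset.sum_congr rfl fun r _ => ?_
      rw [LinearMap.smul_apply, ← map_smul]
      rfl
    apply hg
    change G n = 0
    rw [hG, ← map_zero y, ← hsum, map_sum]
    refine Finset.sum_congr rfl fun r _ => ?_
    rw [map_smul, ← LinearMap.smul_apply, ← hn r]
    rfl
  obtain ⟨m, hm⟩ := hmem
  refine ⟨m, fun r hr => ?_⟩
  have hle : Ideal.span (t : Set R) ≤ Ideal.torsionOf R _ (y - matlisEval R E M m) := by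
    rw [Ideal.span_le]
    intro r hr
    have hmr : r • m = n ⟨r, hr⟩ := congrFun hm ⟨r, hr⟩
    change r • (y - matlisEval R E M m) = 0
    rw [smul_sub, ← map_smul, hmr, hn, sub_self]
  exact hle hr

/-- By purity, an element of `Coker φ` with annihilator `p` lifts to an element of `M°°` killed by
`p`. As `R` is noetherian, the radical in the definition of `IsAssociatedPrime` is immaterial. -/
theorem IsInjectiveHull.not_isAssociatedPrime_coker_iff [IsNoetherianRing R] (M : Type v)
    [AddCommGroup M] [Module R M] (p : Ideal R) [hp : p.IsPrime] :
    ¬ IsAssociatedPrime p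
        (MatlisDual R E (MatlisDual R E M) ⧸ LinearMap.range (matlisEval R E M)) ↔
      Function.Surjective (homLocalizationMap p (matlisEval R E M)) := by
  rw [homLocalizationMap_surjective_iff p (hE.matlisEval_injective ι M), not_iff_comm,
    isAssociatedPrime_iff]
  push Not
  constructor
  · rintro ⟨y, hy, hy'⟩
    refine ⟨hp, Submodule.Quotient.mk y, ?_⟩
    ext r
    rw [Submodule.mem_colon_singleton, Submodule.mem_bot, ← Submodule.Quotient.mk_smul,
      Submodule.Quotient.mk_eq_zero]
    refine ⟨fun hr => ?_, fun hr => ?_⟩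
    · rw [hy r hr]
      exact zero_mem _
    · by_contra h
      exact hy' r h hr
  · rintro ⟨-, x, hx⟩
    obtain ⟨y, rfl⟩ := Submodule.Quotient.mk_surjective _ x
    have hmem : ∀ r, r ∈ p ↔ r • y ∈ LinearMap.range (matlisEval R E M) := by
      intro r
      rw [hx, Submodule.mem_colon_singleton, Submodule.mem_bot, ← Submodule.Quotient.mk_smul,
        Submodule.Quotient.mk_eq_zero]
    obtain ⟨m, hm⟩ := hE.exists_smul_sub_matlisEval_eq_zero ι
      (IsNoetherian.noetherian p) fun r hr => (hmem r).mp hr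
    refine ⟨y - matlisEval R E M m, hm, fun r hr h => hr ((hmem r).mpr ?_)⟩
    rw [smul_sub] at h
    rw [← sub_add_cancel (r • y) (r • matlisEval R E M m)]
    exact add_mem h (Submodule.smul_mem _ _ ⟨m, rfl⟩)

/-- Families of elements of `E[p]` are the values of functionals on any family of elements of
`M` that is linearly independent over `R/p`. -/
theorem IsInjectiveHull.exists_dual_apply_eq {M : Type v} [AddCommGroup M] [Module R M]
    {p : Ideal R} {I : Type*} {m : I → M}
    (hli : ∀ (s : Finset I) (g : I → R), ∑ i ∈ s, g i • m i = 0 → ∀ i ∈ s, g i ∈ p)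
    (e : I → E) (he : ∀ i, ∀ r ∈ p, r • e i = 0) :
    ∃ f : MatlisDual R E M, ∀ i, f (m i) = e i := by
  have := hE.injective_module
  -- the relations between the `m i` have coefficients in `p`, so they hold between the `e i` too
  have hker : LinearMap.ker (Finsupp.linearCombination R m) ≤
      LinearMap.ker (Finsupp.linearCombination R e) := by
    intro c hc
    have h0 : ∀ i ∈ c.support, c i ∈ p := hli c.support c hc
    exact Finset.sum_eq_zero fun i hi => he i _ (h0 i hi)
  obtain ⟨f, hf⟩ := Module.Injective.extension_property R E _ _
    (Submodule.liftQ _ (Finsupp.linearCombination R m) le_rfl)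
    (LinearMap.ker_eq_bot.mp (Submodule.ker_liftQ_eq_bot _ _ _ le_rfl))
    (Submodule.liftQ _ (Finsupp.linearCombination R e) hker)
  refine ⟨f, fun i => ?_⟩
  have := LinearMap.congr_fun hf (Submodule.Quotient.mk (Finsupp.single i 1))
  simpa using this

open Cardinal in
/-- An infinite Bass number strictly increases on passing to the bidual. For linearly independent
`m i ∈ M[p]`, `i ∈ I`, and `s ⊆ I`, injectivity of `E` yields a functional `Ψ s` on `E ^ I` that
restricts to `e ↦ ∑ i ∈ s, e i` on finitely supported families. Composed with
`f ↦ (f (m i))_i` it gives an element of `M°°[p]`, and these are linearly independent over `R/p` as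
soon as the indicator functions of the sets `s` are. -/
theorem IsInjectiveHull.bassNumber_lt_of_aleph0_le (M : Type v) [AddCommGroup M] [Module R M]
    (p : Ideal R) [p.IsPrime] (hM : ℵ₀ ≤ bassNumber p M) :
    bassNumber p M < bassNumber p (MatlisDual R E (MatlisDual R E M)) := by
  classical
  have := hE.injective_module
  let b := Module.Basis.ofVectorSpace p.ResidueField (HomLocalization p M)
  set I := Module.Basis.ofVectorSpaceIndex p.ResidueField (HomLocalization p M)
  have hI : #I = bassNumber p M := b.mk_eq_rank''
  have : Infinite I := Cardinal.infinite_iff.mpr (hI ▸ hM)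
  -- multiplying the basis vectors by units of `κ(p)` removes their denominators
  have hnum : ∀ i, ∃ (w : (R ⧸ p) →ₗ[R] M) (c : p.ResidueFieldˣ),
      c • b i = LocalizedModule.mkLinearMap p.primeCompl _ w := by
    intro i
    obtain ⟨⟨w, s⟩, hws⟩ := IsLocalizedModule.mk'_surjective p.primeCompl
      (LocalizedModule.mkLinearMap p.primeCompl ((R ⧸ p) →ₗ[R] M)) (b i)
    have hs : algebraMap R p.ResidueField s ≠ 0 := by
      rw [Ne, Ideal.algebraMap_residueField_eq_zero]
      exact s.2
    refine ⟨w, Units.mk0 _ hs, ?_⟩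
    rw [Units.smul_def, Units.val_mk0, IsScalarTower.algebraMap_smul, ← hws]
    exact IsLocalizedModule.mk'_cancel'
      (LocalizedModule.mkLinearMap p.primeCompl ((R ⧸ p) →ₗ[R] M)) w s
  choose w c hwc using hnum
  have hli := b.linearIndependent.units_smul c
  have hfun : c • (b : I → HomLocalization p M) =
      fun i => LocalizedModule.mkLinearMap p.primeCompl _ (w i) := funext hwc
  rw [hfun, linearIndependent_homLocalization_iff] at hli
  have hw : ∀ i, ∀ r ∈ p, r • w i 1 = 0 := fun i r hr => smul_quotient_hom_apply_one p (w i) hr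
  -- the functionals `Ψ s`
  have hΨ : ∀ s : Set I, ∃ Ψ : (I → E) →ₗ[R] E, ∀ i e,
      Ψ (Pi.single i e) = if i ∈ s then e else 0 := by
    intro s
    obtain ⟨Ψ, hΨ⟩ := Module.Injective.extension_property R E (I →₀ E) (I → E)
      Finsupp.lcoeFun DFunLike.coe_injective
      (Finsupp.lsum R fun i => if i ∈ s then LinearMap.id else 0)
    refine ⟨Ψ, fun i e => ?_⟩
    have := LinearMap.congr_fun hΨ (Finsupp.single i e)
    simp only [LinearMap.comp_apply, Finsupp.lcoeFun_apply, Finsupp.single_eq_pi_single] at this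
    rw [this]
    by_cases hi : i ∈ s <;> simp [hi]
  choose Ψ hΨ using hΨ
  let ρ : MatlisDual R E M →ₗ[R] (I → E) := LinearMap.pi fun i => LinearMap.applyₗ (w i 1)
  have hρ : ∀ r ∈ p, r • ρ = 0 := by
    intro r hr
    ext f i
    change r • f (w i 1) = 0
    rw [← map_smul, hw i r hr, map_zero]
  choose W hW using fun s : Set I => exists_quotient_hom_apply_one p (m := Ψ s ∘ₗ ρ)
    (by intro r hr; rw [← LinearMap.comp_smul, hρ r hr, LinearMap.comp_zero])
  obtain ⟨S, hIS, hS⟩ := exists_linearIndepOn_indicator p.ResidueField I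
  have hind : LinearIndependent p.ResidueField fun s : S =>
      LocalizedModule.mkLinearMap p.primeCompl _ (W s) := by
    rw [linearIndependent_homLocalization_iff]
    rw [LinearIndepOn, linearIndependent_residueField_iff] at hS
    refine fun T g hg => hS T g (funext fun i => ?_)
    -- the coefficient sum at `i` kills `E[p]`, as seen on functionals supported at `m i`
    have hmem : ∑ s ∈ T, (if i ∈ s.1 then g s else 0) ∈ p := by
      by_contra hnot
      obtain ⟨e, he, hne⟩ := hE.exists_torsion_smul_ne_zero ι hnot
      obtain ⟨f, hf⟩ := hE.exists_dual_apply_eq ι hli (Pi.single i e) fun j r hr => by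
        by_cases hj : j = i
        · subst hj
          simpa using he r hr
        · simp [hj]
      have hρf : ρ f = Pi.single i e := funext hf
      apply hne
      have := LinearMap.congr_fun hg f
      simp only [hW, LinearMap.sum_apply, LinearMap.smul_apply, LinearMap.comp_apply, hρf, hΨ,
        LinearMap.zero_apply] at this
      rw [Finset.sum_smul, ← this]
      refine Finset.sum_congr rfl fun s _ => ?_
      by_cases hi : i ∈ s.1 <;> simp [hi]
    rw [← Ideal.algebraMap_residueField_eq_zero (I := p), map_sum] at hmem
    rw [Finset.sum_apply, Pi.zero_apply, ← hmem]
    refine Finset.sum_congr rfl fun s _ => ?_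
    by_cases hi : i ∈ s.1 <;> simp [hi, Algebra.smul_def]
  exact hI ▸ hIS.trans_le hind.cardinal_le_rank

end Cogenerator

theorem mainTheorem1 {R : Type u} [CommRing R] [IsLocalRing R] [IsNoetherianRing R]
    {E : Type u} [AddCommGroup E] [Module R E]
    (ι : IsLocalRing.ResidueField R →ₗ[R] E) (hE : IsInjectiveHull ι)
    (M : Type v) [AddCommGroup M] [Module R M] (p : Ideal R) [p.IsPrime] :
    bassNumber p M = bassNumber p (MatlisDual R E (MatlisDual R E M)) ↔
      ¬ IsAssociatedPrime p
        (MatlisDual R E (MatlisDual R E M) ⧸ LinearMap.range (matlisEval R E M)) := by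
  rw [hE.not_isAssociatedPrime_coker_iff ι M p]
  have hinj := homLocalizationMap_injective p (hE.matlisEval_injective ι M)
  refine ⟨fun h => ?_, fun h => (LinearEquiv.ofBijective _ ⟨hinj, h⟩).rank_eq⟩
  have hfin : bassNumber p M < Cardinal.aleph0 := by
    by_contra! hle
    exact (hE.bassNumber_lt_of_aleph0_le ι M p hle).ne h
  exact LinearMap.surjective_of_injective_of_rank_eq hinj h hfin
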